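/- A self-avoiding polygon $P$ is a finite connected set of bonds (edges) of the square lattice $\mathbb{Z}^2$ in which every vertex has degree $2$. In each row of lattice cells, draw a horizontal line through the middle of the cells from the extreme left, and another from the extreme right, towards $P$, each terminating where it first meets a vertical bond of $P$; these are the section lines. A section of $P$ is the (nonempty) set of horizontal bonds of a single column of $P$ lying between two neighbouring section lines crossing that column. A section is a duplicate if the section immediately on its left is identical to it. Deleting a duplicate section means slicing the polygon on either side of that section, removing the section, and recombining the two remaining pieces. Write $Q\preceq_s P$ if $Q=P$ or $Q$ is obtained from $P$ by a sequence of such deletions; $P$ is section-minimal if $Q\preceq_s P$ implies $Q=P$. Theorem. Let $k\ge 1$ and $M\ge 0$ be integers. A section-minimal self-avoiding polygon with $6k-4+2M$ vertical bonds contains at most $2M+1$ sections that have $2k$ or more horizontal bonds. -/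

import Mathlib

/-- The square lattice `ℤ²`: two sites are joined by a bond when they are at distance one. -/
def squareLattice : SimpleGraph (ℤ × ℤ) where
  Adj u v := (u.2 = v.2 ∧ |u.1 - v.1| = 1) ∨ (u.1 = v.1 ∧ |u.2 - v.2| = 1)
  symm := ⟨by
    rintro u v (⟨h, h'⟩ | ⟨h, h'⟩)
    · exact Or.inl ⟨h.symm, by rw [abs_sub_comm]; exact h'⟩
    · exact Or.inr ⟨h.symm, by rw [abs_sub_comm]; exact h'⟩⟩
  loopless := ⟨by
    rintro u (⟨_, h⟩ | ⟨_, h⟩) <;> simp at h⟩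

/-- A self-avoiding polygon: a finite connected set of bonds of the square lattice (a bond animal)
in which every site has degree `2`. -/
@[ext] structure SelfAvoidingPolygon where
  graph : squareLattice.Subgraph
  finite_verts : graph.verts.Finite
  connected : graph.Connected
  degree_two : ∀ v ∈ graph.verts, (graph.neighborSet v).ncard = 2

namespace SelfAvoidingPolygon

/-- The horizontal bond at height `y` in column `i` (the strip `i ≤ x ≤ i + 1`) is in `P`. -/
def HasH (P : SelfAvoidingPolygon) (i y : ℤ) : Prop := P.graph.Adj (i, y) (i + 1, y)

/-- The vertical bond at abscissa `x` in row `j` (the strip `j ≤ y ≤ j + 1`) is in `P`. -/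
def HasV (P : SelfAvoidingPolygon) (x j : ℤ) : Prop := P.graph.Adj (x, j) (x, j + 1)

/-- The vertical bonds of `P`. -/
def verticalBonds (P : SelfAvoidingPolygon) : Set (Sym2 (ℤ × ℤ)) :=
  {b | b ∈ P.graph.edgeSet ∧ ∃ x j : ℤ, b = s((x, j), (x, j + 1))}

/-- The section line coming from the extreme left in the middle of row `j` crosses column `i`,
that is, it is not obstructed by a vertical bond at some abscissa `x ≤ i`. -/
def LeftLine (P : SelfAvoidingPolygon) (i j : ℤ) : Prop := ∀ x : ℤ, x ≤ i → ¬ P.HasV x j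

/-- The section line coming from the extreme right in the middle of row `j` crosses column `i`. -/
def RightLine (P : SelfAvoidingPolygon) (i j : ℤ) : Prop := ∀ x : ℤ, i + 1 ≤ x → ¬ P.HasV x j

/-- In row `j` column `i` is crossed by a section line. -/
def SectionLine (P : SelfAvoidingPolygon) (i j : ℤ) : Prop := P.LeftLine i j ∨ P.RightLine i j

/-- In column `i` the rows `c < d` carry two neighbouring section lines. -/
def NeighbouringLines (P : SelfAvoidingPolygon) (i c d : ℤ) : Prop :=
  c < d ∧ P.SectionLine i c ∧ P.SectionLine i d ∧
    ∀ j : ℤ, c < j → j < d → ¬ P.SectionLine i j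

/-- The horizontal bonds of `P` in column `i` between the middle of row `c` and the middle of
row `d`; these are the ones at the heights `c + 1, …, d`. -/
def bondsBetween (P : SelfAvoidingPolygon) (i c d : ℤ) : Set (Sym2 (ℤ × ℤ)) :=
  {b | ∃ y : ℤ, c < y ∧ y ≤ d ∧ P.HasH i y ∧ b = s((i, y), (i + 1, y))}

/-- A section of `P`: the (nonempty) set of horizontal bonds of a column of `P` between two
neighbouring section lines. -/
def IsSection (P : SelfAvoidingPolygon) (S : Set (Sym2 (ℤ × ℤ))) : Prop :=
  S.Nonempty ∧ ∃ i c d : ℤ, P.NeighbouringLines i c d ∧ S = P.bondsBetween i c d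

/-- Column `i` has, between the rows `c` and `d`, a section which is a duplicate: the section
immediately on its left is identical. -/
def IsDuplicate (P : SelfAvoidingPolygon) (i c d : ℤ) : Prop :=
  P.NeighbouringLines i c d ∧ (P.bondsBetween i c d).Nonempty ∧
    P.NeighbouringLines (i - 1) c d ∧
    ∀ y : ℤ, c < y → y ≤ d → (P.HasH (i - 1) y ↔ P.HasH i y)

/-- When the plane is cut along column `i` between the rows `c` and `d`, and along section lines
from the two ends of this cut to infinity, the site `v` lies in the right-hand piece.
Between the two rows this is the part to the right of the cut; everything above row `d` is in the
right-hand piece when the upper section line comes from the left, and in the left-hand piece when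
it comes from the right; likewise below row `c`. -/
def InRightPiece (P : SelfAvoidingPolygon) (i c d : ℤ) (v : ℤ × ℤ) : Prop :=
  (c < v.2 ∧ v.2 ≤ d ∧ i + 1 ≤ v.1) ∨ (d < v.2 ∧ P.LeftLine i d) ∨ (v.2 ≤ c ∧ P.LeftLine i c)

open Classical in
/-- Move the right-hand piece to the left by one, so that it meets the left-hand piece. -/
noncomputable def close (P : SelfAvoidingPolygon) (i c d : ℤ) (v : ℤ × ℤ) : ℤ × ℤ :=
  if P.InRightPiece i c d v then (v.1 - 1, v.2) else v

/-- `Q` is obtained from `P` by the deletion of one duplicate section: the bonds of the section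
are removed (they shrink to single sites), the left-hand piece stays where it is and the
right-hand piece is moved to the left by one, to be recombined with the left-hand one. -/
def DeletesTo (P Q : SelfAvoidingPolygon) : Prop :=
  ∃ i c d : ℤ, P.IsDuplicate i c d ∧
    Q.graph.verts = P.close i c d '' P.graph.verts ∧
    ∀ u v : ℤ × ℤ, Q.graph.Adj u v ↔
      u ≠ v ∧ ∃ u' v' : ℤ × ℤ, P.graph.Adj u' v' ∧ P.close i c d u' = u ∧ P.close i c d v' = v

/-- The order `P ≼ₛ Q`: `P` is `Q`, or is obtained from `Q` by a sequence of section-deletions. -/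
def SectionLE (P Q : SelfAvoidingPolygon) : Prop := Relation.ReflTransGen DeletesTo Q P

/-- `P` is section-minimal: no other polygon is below `P`. -/
def SectionMinimal (P : SelfAvoidingPolygon) : Prop :=
  ∀ Q : SelfAvoidingPolygon, Q.SectionLE P → P = Q

end SelfAvoidingPolygon

/-! Cutting along a section and along its two section lines to infinity splits the vertical bonds
into a left and a right part. Call a section large if it has at least `2k` horizontal bonds.

Each part at a large section has at least `3k - 2` bonds. Every row strictly between the two lines
has a vertical bond on either side, and the number on a side has the parity of the number of
horizontal bonds of the section below that row. So a row costs at least 1 or 2 according to this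
parity (`add_half_le_sum_of_alternating`, `NeighbouringLines.le_sum`). If there are no duplicates, a
vertical bond adjoins the section on both sides (`exists_hasV_left`, `exists_hasV_right`).

The cuts do not cross (`isRightOf_iff_or_isRightOf_iff`). Given `n ≥ 2` large sections, two extreme
ones have disjoint outer parts, with at least `6k - 4` bonds together. Outside these lie the inner
boundary bond of the first extreme section and one boundary bond for each of the other `n - 2`
sections, all distinct. Hence `6k - 4 + n - 1 ≤ 6k - 4 + 2M`.

Section-minimality excludes duplicates because deleting one yields a different polygon (`deletion`,
`ne_deletion`). -/

/-! ### Counting in a laminar family of bipartitions. -/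

/-- `A S true` and `A S false` are the two parts of `B` cut by `S`, `bd S b` is a boundary element
in `A S b`, and `side S S'` names the part of `S` facing `S'`. The disjoint pieces counted are `A S0
τ`, `bd S0 !τ`, `O S1` and one `o S` for each remaining `S`. -/
theorem two_mul_add_card_le_of_laminar {ι β : Type*} (s : Finset ι)
    (hs : s.Nonempty) (B : Finset β) (A : ι → Bool → Finset β) (bd : ι → Bool → β)
    (side : ι → ι → Bool) (m : ℕ)
    (hAB : ∀ S ∈ s, ∀ b, A S b ⊆ B)
    (hdisj : ∀ S ∈ s, ∀ b, Disjoint (A S b) (A S !b))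
    (hcover : ∀ S ∈ s, ∀ b, ∀ x ∈ B, x ∈ A S b ∨ x ∈ A S !b)
    (hbd : ∀ S ∈ s, ∀ b, bd S b ∈ A S b)
    (h1 : ∀ S ∈ s, ∀ S' ∈ s, S ≠ S' → Disjoint (A S !(side S S')) (A S' !(side S' S)))
    (h2 : ∀ S ∈ s, ∀ S' ∈ s, S ≠ S' → bd S (side S S') ∉ A S' !(side S' S))
    (hm : ∀ S ∈ s, ∀ b, m ≤ (A S b).card) :
    2 * m + s.card ≤ B.card + 1 := by
  classical
  simp only [Finset.disjoint_left] at hdisj h1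
  have h2' : ∀ S ∈ s, ∀ S' ∈ s, S ≠ S' → ∀ b, bd S b ∉ A S' !(side S' S) := by
    intro S hS S' hS' hne b
    by_cases hb : b = side S S'
    · rw [hb]; exact h2 S hS S' hS' hne
    · have : b = !(side S S') := Bool.eq_not.2 hb
      rw [this]; exact h1 S hS S' hS' hne (hbd S hS _)
  obtain ⟨⟨S0, τ⟩, hmem, hmin⟩ := Finset.exists_min_image (s ×ˢ (Finset.univ : Finset Bool))
    (fun q => (A q.1 q.2).card) (hs.product Finset.univ_nonempty)
  have hS0 : S0 ∈ s := (Finset.mem_product.1 hmem).1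
  -- A section on the side `τ` of `S0` would have its outer part inside `A S0 τ` without `bd S0 τ`,
  -- against minimality.
  have hside : ∀ S ∈ s, S ≠ S0 → side S0 S = !τ := by
    intro S hS hne
    by_contra hcon
    have hβ : side S0 S = τ := by simpa using hcon
    have hsub : A S (!(side S S0)) ⊆ (A S0 τ).erase (bd S0 τ) := by
      intro x hx
      rw [Finset.mem_erase]
      constructor
      · rintro rfl
        exact h2' S0 hS0 S hS hne.symm τ hx
      · rcases hcover S0 hS0 τ x (hAB S hS _ hx) with h | h
        · exact h
        · rw [← hβ] at h
          exact absurd hx (h1 S0 hS0 S hS hne.symm h)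
    have hle := Finset.card_le_card hsub
    have hlt := Finset.card_erase_lt_of_mem (hbd S0 hS0 τ)
    have := hmin (S, !(side S S0)) (Finset.mem_product.2 ⟨hS, Finset.mem_univ _⟩)
    simp only at this
    omega
  -- `O S` is the part of `S` away from `S0`, and `o S` its boundary element.
  set O : ι → Finset β := fun S => A S !(side S S0) with hO
  set o : ι → β := fun S => bd S !(side S S0) with ho
  have hoO : ∀ S ∈ s, o S ∈ O S := fun S hS => hbd S hS _
  have hOU : ∀ S ∈ s, S ≠ S0 → ∀ x ∈ O S, x ∉ A S0 τ := by
    intro S hS hne x hx hx'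
    have := h1 S0 hS0 S hS hne.symm (a := x)
    rw [hside S hS hne, Bool.not_not] at this
    exact this hx' hx
  have hOb : ∀ S ∈ s, S ≠ S0 → ∀ b, bd S0 b ∉ O S :=
    fun S hS hne b => h2' S0 hS0 S hS hne.symm b
  have hOU' : ∀ b ∈ ({bd S0 !τ} : Finset β), b ∉ A S0 τ := by
    intro b hb
    rw [Finset.mem_singleton] at hb
    subst hb
    have := hdisj S0 hS0 (!τ) (hbd S0 hS0 (!τ))
    rwa [Bool.not_not] at this
  rcases (s.erase S0).eq_empty_or_nonempty with hemp | hne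
  · have hcard : s.card = 1 := by
      have := Finset.card_erase_add_one hS0
      rw [hemp] at this
      simpa using this.symm
    have hd : Disjoint (A S0 τ) (A S0 !τ) := Finset.disjoint_left.2 (hdisj S0 hS0 τ)
    have := Finset.card_le_card (Finset.union_subset (hAB S0 hS0 τ) (hAB S0 hS0 !τ))
    rw [Finset.card_union_of_disjoint hd] at this
    have e1 := hm S0 hS0 τ
    have e2 := hm S0 hS0 !τ
    omega
  · obtain ⟨S1, hS1, hmin1⟩ := Finset.exists_min_image (s.erase S0) (fun S => (O S).card) hne
    obtain ⟨hS1ne, hS1s⟩ := Finset.mem_erase.1 hS1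
    have hkey : ∀ S ∈ s, ∀ S' ∈ s, S ≠ S0 → S' ≠ S → side S S' = side S S0 → o S' ∉ O S := by
      intro S hS S' hS' _ hne' hsd hmem'
      have := h2' S' hS' S hS hne' (!(side S' S0))
      rw [hsd] at this
      exact this hmem'
    -- `S` and `S'` cannot both separate the other from `S0`: otherwise `bd S0 τ` would lie in both
    -- of two disjoint outer parts.
    have hboth : ∀ S ∈ s, ∀ S' ∈ s, S ≠ S0 → S' ≠ S0 → S' ≠ S → side S S' ≠ side S S0 →
        side S' S = side S' S0 := by
      intro S hS S' hS' hn hn' hne' hsd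
      by_contra hsd'
      have e1 : (!(side S S')) = side S S0 := (Bool.eq_not.2 (Ne.symm hsd)).symm
      have e2 : (!(side S' S)) = side S' S0 := (Bool.eq_not.2 (Ne.symm hsd')).symm
      have hb : ∀ T ∈ s, T ≠ S0 → bd S0 τ ∈ A T (side T S0) := by
        intro T hT hTn
        rcases hcover T hT (side T S0) (bd S0 τ) (hAB S0 hS0 _ (hbd S0 hS0 τ)) with h | h
        · exact h
        · exact absurd h (hOb T hT hTn τ)
      have := h1 S hS S' hS' hne'.symm (a := bd S0 τ)
      rw [e1, e2] at this
      exact this (hb S hS hn) (hb S' hS' hn')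
    have hinj : Set.InjOn o ((s.erase S0).erase S1 : Finset ι) := by
      intro S hS S' hS' heq
      simp only [Finset.coe_erase, Set.mem_sdiff, Finset.mem_coe, Set.mem_singleton_iff] at hS hS'
      obtain ⟨⟨hS, hn⟩, -⟩ := hS
      obtain ⟨⟨hS', hn'⟩, -⟩ := hS'
      by_contra hne'
      have hne'' : S' ≠ S := fun h => hne' h.symm
      by_cases hsd : side S S' = side S S0
      · exact hkey S hS S' hS' hn hne'' hsd (heq ▸ hoO S hS)
      · exact hkey S' hS' S hS hn' hne' (hboth S hS S' hS' hn hn' hne'' hsd) (heq ▸ hoO S' hS')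
    have hnot : ∀ S ∈ (s.erase S0).erase S1, o S ∉ O S1 := by
      intro S hS
      simp only [Finset.mem_erase] at hS
      obtain ⟨hn1, hn0, hS⟩ := hS
      by_cases hsd : side S1 S = side S1 S0
      · exact hkey S1 hS1s S hS hS1ne hn1 hsd
      · exfalso
        have hsd' := hboth S1 hS1s S hS hS1ne hn0 hn1 hsd
        have e1 : side S1 S = !(side S1 S0) := Bool.eq_not.2 hsd
        -- A section beyond `S1` would have a strictly smaller outer part, against the choice of
        -- `S1`.
        have hsub : O S ⊆ (O S1).erase (o S1) := by
          intro x hx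
          have hx' : x ∈ A S !(side S S1) := by rw [hsd']; exact hx
          rw [Finset.mem_erase]
          constructor
          · rintro rfl
            exact h2' S1 hS1s S hS (Ne.symm hn1) _ hx'
          · rcases hcover S1 hS1s (side S1 S) x (hAB S hS _ hx) with h | h
            · rw [e1] at h; exact h
            · exact absurd hx' (h1 S1 hS1s S hS (Ne.symm hn1) h)
        have hle := Finset.card_le_card hsub
        have hlt := Finset.card_erase_lt_of_mem (hoO S1 hS1s)
        have := hmin1 S (Finset.mem_erase.2 ⟨hn0, hS⟩)
        omega
    set W := ((s.erase S0).erase S1).image o with hW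
    have hWc : W.card + 2 = s.card := by
      rw [hW, Finset.card_image_of_injOn hinj]
      have := Finset.card_erase_add_one hS1
      have := Finset.card_erase_add_one hS0
      omega
    have d1 : Disjoint (A S0 τ) {bd S0 !τ} := Finset.disjoint_right.2 hOU'
    have d2 : Disjoint (A S0 τ ∪ {bd S0 !τ}) (O S1) := by
      rw [Finset.disjoint_right]
      intro x hx hx'
      rcases Finset.mem_union.1 hx' with h | h
      · exact hOU S1 hS1s hS1ne x hx h
      · rw [Finset.mem_singleton] at h
        subst h
        exact hOb S1 hS1s hS1ne _ hx
    have d3 : Disjoint ((A S0 τ ∪ {bd S0 !τ}) ∪ O S1) W := by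
      rw [Finset.disjoint_right]
      intro x hx hx'
      obtain ⟨S, hS, rfl⟩ := Finset.mem_image.1 hx
      have hS2 := hS
      simp only [Finset.mem_erase] at hS2
      obtain ⟨hn1, hn0, hSs⟩ := hS2
      rcases Finset.mem_union.1 hx' with h | h
      · rcases Finset.mem_union.1 h with h | h
        · exact hOU S hSs hn0 _ (hoO S hSs) h
        · rw [Finset.mem_singleton] at h
          exact hOb S hSs hn0 (!τ) (h ▸ hoO S hSs)
      · exact hnot S hS h
    have hsub : ((A S0 τ ∪ {bd S0 !τ}) ∪ O S1) ∪ W ⊆ B := by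
      refine Finset.union_subset (Finset.union_subset (Finset.union_subset (hAB S0 hS0 τ) ?_)
        (hAB S1 hS1s _)) ?_
      · intro x hx
        rw [Finset.mem_singleton] at hx
        subst hx
        exact hAB S0 hS0 _ (hbd S0 hS0 !τ)
      · intro x hx
        obtain ⟨S, hS, rfl⟩ := Finset.mem_image.1 hx
        simp only [Finset.mem_erase] at hS
        exact hAB S hS.2.2 _ (hoO S hS.2.2)
    have := Finset.card_le_card hsub
    rw [Finset.card_union_of_disjoint d3, Finset.card_union_of_disjoint d2,
      Finset.card_union_of_disjoint d1, Finset.card_singleton] at this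
    have e1 := hm S0 hS0 τ
    have e2 : m ≤ (O S1).card := hm S1 hS1s _
    omega

/-! ### Parity of the number of vertical bonds in a row. -/

namespace SelfAvoidingPolygon

variable (P : SelfAvoidingPolygon)

open Classical in
theorem degree_sum (x y : ℤ) :
    ((if P.HasH (x - 1) y then 1 else 0) + (if P.HasH x y then 1 else 0) +
      (if P.HasV x (y - 1) then 1 else 0) + (if P.HasV x y then 1 else 0) = 0 ∨
    (if P.HasH (x - 1) y then 1 else 0) + (if P.HasH x y then 1 else 0) +
      (if P.HasV x (y - 1) then 1 else 0) + (if P.HasV x y then 1 else 0) = 2) ∧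
    ((x, y) ∈ P.graph.verts →
      (if P.HasH (x - 1) y then 1 else 0) + (if P.HasH x y then 1 else 0) +
      (if P.HasV x (y - 1) then 1 else 0) + (if P.HasV x y then 1 else 0) = 2) := by
  by_cases hv : (x, y) ∈ P.graph.verts
  · suffices h : (if P.HasH (x - 1) y then 1 else 0) + (if P.HasH x y then 1 else 0) +
      (if P.HasV x (y - 1) then 1 else 0) + (if P.HasV x y then 1 else 0) = 2 from
      ⟨Or.inr h, fun _ => h⟩
    have h2 := P.degree_two _ hv
    have hset : P.graph.neighborSet (x, y) =
        ((({(x - 1, y), (x + 1, y), (x, y - 1), (x, y + 1)} : Finset (ℤ × ℤ)).filter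
          (fun w => P.graph.Adj (x, y) w) : Finset (ℤ × ℤ)) : Set (ℤ × ℤ)) := by
      ext ⟨a, b⟩
      simp only [SimpleGraph.Subgraph.mem_neighborSet, Finset.coe_filter, Finset.mem_insert,
        Finset.mem_singleton, Set.mem_ofPred_eq, Prod.mk.injEq]
      refine ⟨fun h => ⟨?_, h⟩, fun h => h.2⟩
      have := P.graph.adj_sub h
      simp only [squareLattice] at this
      rcases this with ⟨h1, h2⟩ | ⟨h1, h2⟩ <;>
      · rw [abs_eq (by norm_num)] at h2
        omega
    rw [hset, Set.ncard_coe_finset, Finset.card_filter, Finset.sum_insert, Finset.sum_insert,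
      Finset.sum_insert, Finset.sum_singleton] at h2
    · have e1 : P.graph.Adj (x, y) (x - 1, y) ↔ P.HasH (x - 1) y := by
        rw [HasH, P.graph.adj_comm, sub_add_cancel]
      have e2 : P.graph.Adj (x, y) (x, y - 1) ↔ P.HasV x (y - 1) := by
        rw [HasV, P.graph.adj_comm, sub_add_cancel]
      have e3 : P.graph.Adj (x, y) (x + 1, y) ↔ P.HasH x y := Iff.rfl
      have e4 : P.graph.Adj (x, y) (x, y + 1) ↔ P.HasV x y := Iff.rfl
      simp only [e1, e2, e3, e4] at h2
      omega
    all_goals simp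
    all_goals omega
  · have h1 : ¬ P.HasH (x - 1) y := fun h => hv (by
      have := P.graph.edge_vert h.symm; rwa [sub_add_cancel] at this)
    have h2 : ¬ P.HasH x y := fun h => hv (P.graph.edge_vert h)
    have h3 : ¬ P.HasV x (y - 1) := fun h => hv (by
      have := P.graph.edge_vert h.symm; rwa [sub_add_cancel] at this)
    have h4 : ¬ P.HasV x y := fun h => hv (P.graph.edge_vert h)
    simp [h1, h2, h3, h4, hv]

theorem exists_bound : ∃ K : ℤ, ∀ v ∈ P.graph.verts, -K < v.1 ∧ v.1 < K ∧ -K < v.2 ∧ v.2 < K := by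
  obtain ⟨K, hK⟩ := (P.finite_verts.image (fun v => |v.1| + |v.2|)).bddAbove
  refine ⟨K + 1, fun v hv => ?_⟩
  have := hK (Set.mem_image_of_mem _ hv)
  change |v.1| + |v.2| ≤ K at this
  have h1 := abs_nonneg v.1
  have h2 := abs_nonneg v.2
  have h3 := abs_le.1 (show |v.1| ≤ K by omega)
  have h4 := abs_le.1 (show |v.2| ≤ K by omega)
  omega

theorem finite_hasV : {b : ℤ × ℤ | P.HasV b.1 b.2}.Finite :=
  P.finite_verts.subset fun _ h => P.graph.edge_vert h

/-- The vertical bonds, each represented by its lower end. -/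
noncomputable def bondFinset : Finset (ℤ × ℤ) := P.finite_hasV.toFinset

@[simp] theorem mem_bondFinset {b : ℤ × ℤ} : b ∈ P.bondFinset ↔ P.HasV b.1 b.2 := by
  simp [bondFinset]

theorem ncard_verticalBonds : P.verticalBonds.ncard = P.bondFinset.card := by
  have : P.verticalBonds =
      (fun b : ℤ × ℤ => s((b.1, b.2), (b.1, b.2 + 1))) '' (P.bondFinset : Set (ℤ × ℤ)) := by
    ext e
    simp only [verticalBonds, Set.mem_ofPred_eq, Set.mem_image, Finset.mem_coe, mem_bondFinset,
      Prod.exists]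
    constructor
    · rintro ⟨he, x, j, rfl⟩
      exact ⟨x, j, he, rfl⟩
    · rintro ⟨x, j, h, rfl⟩
      exact ⟨h, x, j, rfl⟩
  rw [this, Set.ncard_image_of_injective, Set.ncard_coe_finset]
  rintro ⟨x, j⟩ ⟨x', j'⟩ h
  simp only [Sym2.eq_iff, Prod.mk.injEq] at h
  ext <;> simp only <;> omega

/-- The number of vertical bonds in row `j` to the right of column `i`. -/
noncomputable def rightCount (i j : ℤ) : ℕ := (P.bondFinset.filter (fun b => b.2 = j ∧ i < b.1)).card

/-- The number of vertical bonds in row `j` to the left of column `i`. -/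
noncomputable def leftCount (i j : ℤ) : ℕ := (P.bondFinset.filter (fun b => b.2 = j ∧ b.1 ≤ i)).card

theorem rightCount_eq_zero {i j : ℤ} : P.rightCount i j = 0 ↔ P.RightLine i j := by
  rw [rightCount, Finset.card_eq_zero, Finset.filter_eq_empty_iff]
  constructor
  · intro h x hx hV
    exact h (x := (x, j)) (by simpa using hV) ⟨rfl, by simp only; omega⟩
  · rintro h ⟨x, y⟩ hb ⟨rfl, hx⟩
    exact h x (by simp only at hx; omega) (by simpa using hb)

theorem leftCount_eq_zero {i j : ℤ} : P.leftCount i j = 0 ↔ P.LeftLine i j := by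
  rw [leftCount, Finset.card_eq_zero, Finset.filter_eq_empty_iff]
  constructor
  · intro h x hx hV
    exact h (x := (x, j)) (by simpa using hV) ⟨rfl, hx⟩
  · rintro h ⟨x, y⟩ hb ⟨rfl, hx⟩
    exact h x hx (by simpa using hb)

open Classical in
theorem rightCount_sub_one (i j : ℤ) :
    P.rightCount (i - 1) j = P.rightCount i j + if P.HasV i j then 1 else 0 := by
  have : P.bondFinset.filter (fun b => b.2 = j ∧ i - 1 < b.1) =
      P.bondFinset.filter (fun b => b.2 = j ∧ i < b.1) ∪
        (if P.HasV i j then {(i, j)} else ∅) := by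
    ext ⟨x, y⟩
    split_ifs with h <;> simp only [Finset.mem_filter, Finset.mem_union, mem_bondFinset,
      Finset.mem_singleton, Prod.mk.injEq, Finset.notMem_empty, or_false] <;>
    constructor
    · rintro ⟨h1, h2, h3⟩
      by_cases hx : x = i
      · exact Or.inr ⟨hx, h2⟩
      · exact Or.inl ⟨h1, h2, by omega⟩
    · rintro (⟨h1, h2, h3⟩ | ⟨rfl, rfl⟩)
      · exact ⟨h1, h2, by omega⟩
      · exact ⟨h, rfl, by omega⟩
    · rintro ⟨h1, rfl, h3⟩
      refine ⟨h1, rfl, ?_⟩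
      rcases eq_or_ne x i with rfl | hx
      · exact absurd h1 h
      · omega
    · rintro ⟨h1, h2, h3⟩
      exact ⟨h1, h2, by omega⟩
  rw [rightCount, this, Finset.card_union_of_disjoint, rightCount]
  · split_ifs <;> rfl
  · rw [Finset.disjoint_left]
    rintro ⟨x, y⟩ h1 h2
    split_ifs at h2
    · simp only [Finset.mem_filter, Finset.mem_singleton, Prod.mk.injEq] at h1 h2
      omega
    · simp at h2

theorem leftCount_add_rightCount (i j : ℤ) :
    P.leftCount i j + P.rightCount i j = (P.bondFinset.filter (fun b => b.2 = j)).card := by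
  rw [leftCount, rightCount, ← Finset.filter_filter, ← Finset.filter_filter]
  simp only [← not_le]
  exact Finset.card_filter_add_card_filter_not _

open Classical in
-- Moving one column to the left past `(x, y)` changes the sum by a number with the parity of the
-- degree of that site, which is 0 or 2. Far to the right all terms vanish.
theorem even_rightCount_add (i y : ℤ) :
    Even (P.rightCount i y + P.rightCount i (y - 1) + if P.HasH i y then 1 else 0) := by
  obtain ⟨K, hK⟩ := P.exists_bound
  have key : ∀ n : ℕ, ∀ i : ℤ, i = K - n →
      Even (P.rightCount i y + P.rightCount i (y - 1) + if P.HasH i y then 1 else 0) := by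
    intro n
    induction n with
    | zero =>
      rintro i rfl
      have h1 : ∀ j, P.rightCount (K - (0 : ℕ)) j = 0 := by
        intro j
        rw [rightCount_eq_zero]
        intro x hx h
        have := hK _ (P.graph.edge_vert h)
        simp only at this
        push_cast at hx
        omega
      have h2 : ¬ P.HasH (K - (0 : ℕ)) y := by
        intro h
        have := hK _ (P.graph.edge_vert h)
        simp at this
      rw [h1, h1, if_neg h2]
      exact ⟨0, rfl⟩
    | succ n ih =>
      rintro i rfl
      have := ih _ rfl
      have e : K - ((n + 1 : ℕ) : ℤ) = (K - n) - 1 := by push_cast; ring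
      rw [e, rightCount_sub_one, rightCount_sub_one]
      have hd := (P.degree_sum (K - n) y).1
      rw [Nat.even_iff] at this ⊢
      omega
  by_cases hi : i ≤ K
  · exact key (K - i).toNat i (by omega)
  · have h1 : ∀ j, P.rightCount i j = 0 := by
      intro j
      rw [rightCount_eq_zero]
      intro x hx h
      have := hK _ (P.graph.edge_vert h)
      simp only at this
      omega
    have h2 : ¬ P.HasH i y := by
      intro h
      have := hK _ (P.graph.edge_vert h)
      simp only at this
      omega
    rw [h1, h1, if_neg h2]
    exact ⟨0, rfl⟩

/-- In a column left of the polygon there is no horizontal bond, so `even_rightCount_add` gives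
neighbouring rows equal parity, starting from the empty rows below. -/
theorem even_card_row (j : ℤ) : Even (P.bondFinset.filter (fun b => b.2 = j)).card := by
  obtain ⟨K, hK⟩ := P.exists_bound
  have hl : ∀ j, P.leftCount (-K) j = 0 := by
    intro j
    rw [leftCount_eq_zero]
    intro x hx h
    have := hK _ (P.graph.edge_vert h)
    simp only at this
    omega
  have hh : ∀ y, ¬ P.HasH (-K) y := by
    intro y h
    have := hK _ (P.graph.edge_vert h)
    simp only at this
    omega
  have low : ∀ j, j ≤ -K → P.rightCount (-K) j = 0 := by
    intro j hj
    rw [rightCount_eq_zero]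
    intro x hx h
    have := hK _ (P.graph.edge_vert h)
    simp only at this
    omega
  rw [← P.leftCount_add_rightCount (-K), hl, zero_add]
  have key : ∀ n : ℕ, Even (P.rightCount (-K) (-K + n)) := by
    intro n
    induction n with
    | zero => rw [low _ (by simp)]; exact ⟨0, rfl⟩
    | succ n ih =>
      have := P.even_rightCount_add (-K) (-K + (n + 1 : ℕ))
      rw [if_neg (hh _), show -K + ((n + 1 : ℕ) : ℤ) - 1 = -K + n by push_cast; ring] at this
      rw [Nat.even_iff] at this ih ⊢
      omega
  by_cases hj : j ≤ -K
  · rw [low j hj]; exact ⟨0, rfl⟩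
  · have := key (j + K).toNat
    rwa [show -K + ((j + K).toNat : ℤ) = j by omega] at this

theorem even_rightCount_of_sectionLine {i j : ℤ} (h : P.SectionLine i j) :
    Even (P.rightCount i j) := by
  rcases h with h | h
  · have h1 := P.leftCount_eq_zero.2 h
    have h2 := P.leftCount_add_rightCount i j
    rw [h1, zero_add] at h2
    rw [h2]
    exact P.even_card_row j
  · rw [P.rightCount_eq_zero.2 h]
    exact ⟨0, rfl⟩

end SelfAvoidingPolygon

/-! ### The two sides of a section, and why cuts do not cross. -/

namespace SelfAvoidingPolygon

variable (P : SelfAvoidingPolygon)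

/-- The vertical bond `b` lies to the right of the section in column `i` between the section lines
in the rows `c` and `d`. -/
def IsRightOf (i c d : ℤ) (b : ℤ × ℤ) : Prop :=
  (c < b.2 ∧ b.2 < d ∧ i < b.1) ∨ (d ≤ b.2 ∧ P.LeftLine i d) ∨ (b.2 ≤ c ∧ P.LeftLine i c)

/-- The section `(i', c', d')` lies to the right of the section `(i, c, d)`. -/
def SectionIsRightOf (i c d i' c' d' : ℤ) : Prop :=
  (c' + 1 < d ∧ c + 1 < d' ∧ i < i') ∨ (d ≤ c' + 1 ∧ P.LeftLine i d) ∨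
    (d' ≤ c + 1 ∧ P.LeftLine i c)

variable {P}

theorem NeighbouringLines.exists_hasV {i c d : ℤ} (h : P.NeighbouringLines i c d) {j : ℤ}
    (hc : c < j) (hd : j < d) : (∃ x, x ≤ i ∧ P.HasV x j) ∧ ∃ x, i < x ∧ P.HasV x j := by
  have := h.2.2.2 j hc hd
  rw [SectionLine, not_or, LeftLine, RightLine] at this
  push Not at this
  exact this

theorem LeftLine.lt {i j x : ℤ} (h : P.LeftLine i j) (hV : P.HasV x j) : i < x := by
  by_contra hx
  exact h x (by omega) hV

theorem RightLine.le {i j x : ℤ} (h : P.RightLine i j) (hV : P.HasV x j) : x ≤ i := by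
  by_contra hx
  exact h x (by omega) hV

theorem SectionLine.rightLine {i j : ℤ} (h : P.SectionLine i j) (h' : ¬ P.LeftLine i j) :
    P.RightLine i j := h.resolve_left h'

theorem exists_hasV_of_not_leftLine {i j : ℤ} (h : ¬ P.LeftLine i j) :
    ∃ x, x ≤ i ∧ P.HasV x j := by
  rw [LeftLine] at h
  push Not at h
  exact h

/-- A row strictly inside a section has vertical bonds on both sides of its column. So a line of one
section running in such a row of the other must come from the side away from the other section. -/
theorem isRightOf_or_of_lt {i c d i' c' d' : ℤ} (h : P.NeighbouringLines i c d)
    (h' : P.NeighbouringLines i' c' d') (h1 : c' + 1 < d) (h2 : c + 1 < d') (hi : i < i')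
    {b : ℤ × ℤ} (hd' : c' + 1 < d') :
    P.IsRightOf i c d b ∨ ¬ P.IsRightOf i' c' d' b := by
  by_contra hcon
  rw [not_or, not_not] at hcon
  obtain ⟨hn, hr⟩ := hcon
  have hn1 : c < b.2 → b.2 < d → b.1 ≤ i := fun e1 e2 => by
    by_contra e3
    exact hn (Or.inl ⟨e1, e2, by omega⟩)
  have hn2 : d ≤ b.2 → ¬ P.LeftLine i d := fun e1 e2 => hn (Or.inr (Or.inl ⟨e1, e2⟩))
  have hn3 : b.2 ≤ c → ¬ P.LeftLine i c := fun e1 e2 => hn (Or.inr (Or.inr ⟨e1, e2⟩))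
  rcases hr with ⟨e1, e2, e3⟩ | ⟨e1, e2⟩ | ⟨e1, e2⟩
  · rcases lt_trichotomy b.2 c with hlt | heq | hgt
    · obtain ⟨-, x, hx, hV⟩ := h'.exists_hasV (j := c) (by omega) (by omega)
      have := (h.2.1.rightLine (hn3 hlt.le)).le hV
      omega
    · obtain ⟨-, x, hx, hV⟩ := h'.exists_hasV (j := c) (by omega) (by omega)
      have := (h.2.1.rightLine (hn3 heq.le)).le hV
      omega
    · by_cases hbd : b.2 < d
      · have := hn1 hgt hbd
        omega
      · obtain ⟨-, x, hx, hV⟩ := h'.exists_hasV (j := d) (by omega) (by omega)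
        have := (h.2.2.1.rightLine (hn2 (by omega))).le hV
        omega
  · rcases lt_trichotomy d d' with hlt | heq | hgt
    · obtain ⟨-, x, hx, hV⟩ := h'.exists_hasV (j := d) (by omega) (by omega)
      have := (h.2.2.1.rightLine (hn2 (by omega))).le hV
      omega
    · subst heq
      obtain ⟨x, hx, hV⟩ := exists_hasV_of_not_leftLine (hn2 e1)
      have := e2.lt hV
      omega
    · obtain ⟨⟨x, hx, hV⟩, -⟩ := h.exists_hasV (j := d') (by omega) (by omega)
      have := e2.lt hV
      omega
  · rcases lt_trichotomy c c' with hlt | heq | hgt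
    · obtain ⟨⟨x, hx, hV⟩, -⟩ := h.exists_hasV (j := c') (by omega) (by omega)
      have := e2.lt hV
      omega
    · subst heq
      obtain ⟨x, hx, hV⟩ := exists_hasV_of_not_leftLine (hn3 e1)
      have := e2.lt hV
      omega
    · obtain ⟨-, x, hx, hV⟩ := h'.exists_hasV (j := c) (by omega) (by omega)
      have := (h.2.1.rightLine (hn3 (by omega))).le hV
      omega

theorem isRightOf_iff_of_le {i c d : ℤ} {b : ℤ × ℤ} (h : c < d) (hb : d ≤ b.2) :
    P.IsRightOf i c d b ↔ P.LeftLine i d := by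
  constructor
  · rintro (h | h | h)
    · omega
    · exact h.2
    · omega
  · exact fun h => Or.inr (Or.inl ⟨hb, h⟩)

theorem isRightOf_iff_of_ge {i c d : ℤ} {b : ℤ × ℤ} (h : c < d) (hb : b.2 ≤ c) :
    P.IsRightOf i c d b ↔ P.LeftLine i c := by
  constructor
  · rintro (h | h | h)
    · omega
    · omega
    · exact h.2
  · exact fun h => Or.inr (Or.inr ⟨hb, h⟩)

theorem isRightOf_iff_of_mem {i c d : ℤ} {b : ℤ × ℤ} (hc : c < b.2) (hd : b.2 < d) :
    P.IsRightOf i c d b ↔ i < b.1 := by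
  constructor
  · rintro (h | h | h)
    · exact h.2.2
    · omega
    · omega
  · exact fun h => Or.inl ⟨hc, hd, h⟩

theorem sectionIsRightOf_iff_of_le {i c d i' c' d' : ℤ} (hd : c + 1 < d) (hd' : c' + 1 < d')
    (h : d ≤ c' + 1) : P.SectionIsRightOf i c d i' c' d' ↔ P.LeftLine i d := by
  constructor
  · rintro (h | h | h)
    · omega
    · exact h.2
    · omega
  · exact fun h' => Or.inr (Or.inl ⟨h, h'⟩)

theorem sectionIsRightOf_iff_of_ge {i c d i' c' d' : ℤ} (hd : c + 1 < d) (hd' : c' + 1 < d')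
    (h : d' ≤ c + 1) : P.SectionIsRightOf i c d i' c' d' ↔ P.LeftLine i c := by
  constructor
  · rintro (h | h | h)
    · omega
    · omega
    · exact h.2
  · exact fun h' => Or.inr (Or.inr ⟨h, h'⟩)

theorem sectionIsRightOf_iff_of_lt {i c d i' c' d' : ℤ} (h1 : c' + 1 < d) (h2 : c + 1 < d') :
    P.SectionIsRightOf i c d i' c' d' ↔ i < i' := by
  constructor
  · rintro (h | h | h)
    · exact h.2.2
    · omega
    · omega
  · exact fun h' => Or.inl ⟨h1, h2, h'⟩

theorem NeighbouringLines.eq_of_overlap {i c d c' d' : ℤ} (h : P.NeighbouringLines i c d)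
    (h' : P.NeighbouringLines i c' d') (h1 : c' + 1 < d) (h2 : c + 1 < d') :
    c = c' ∧ d = d' := by
  have e1 : ¬ c < c' := fun hlt => h.2.2.2 c' hlt (by omega) h'.2.1
  have e2 : ¬ c' < c := fun hlt => h'.2.2.2 c hlt (by omega) h.2.1
  have e3 : ¬ d < d' := fun hlt => h'.2.2.2 d (by omega) hlt h.2.2.1
  have e4 : ¬ d' < d := fun hlt => h.2.2.2 d' (by omega) hlt h'.2.2.1
  omega

/-- In complementary form, the outer parts of two sections are disjoint: hypothesis `h1` of the
counting lemma. -/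
theorem isRightOf_iff_or_isRightOf_iff {i c d i' c' d' : ℤ} (h : P.NeighbouringLines i c d)
    (h' : P.NeighbouringLines i' c' d') (hd : c + 1 < d) (hd' : c' + 1 < d')
    (hne : (i, c, d) ≠ (i', c', d')) {b : ℤ × ℤ} :
    (P.IsRightOf i c d b ↔ P.SectionIsRightOf i c d i' c' d') ∨
      (P.IsRightOf i' c' d' b ↔ P.SectionIsRightOf i' c' d' i c d) := by
  by_cases h1 : d ≤ c' + 1
  · rw [sectionIsRightOf_iff_of_le hd hd' h1, sectionIsRightOf_iff_of_ge hd' hd h1]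
    by_cases hbd : d ≤ b.2
    · exact Or.inl (isRightOf_iff_of_le h.1 hbd)
    · exact Or.inr (isRightOf_iff_of_ge h'.1 (by omega))
  by_cases h2 : d' ≤ c + 1
  · rw [sectionIsRightOf_iff_of_ge hd hd' h2, sectionIsRightOf_iff_of_le hd' hd h2]
    by_cases hbd : d' ≤ b.2
    · exact Or.inr (isRightOf_iff_of_le h'.1 hbd)
    · exact Or.inl (isRightOf_iff_of_ge h.1 (by omega))
  push Not at h1 h2
  rw [sectionIsRightOf_iff_of_lt h1 h2, sectionIsRightOf_iff_of_lt h2 h1]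
  rcases lt_trichotomy i i' with hi | rfl | hi
  · have := isRightOf_or_of_lt h h' h1 h2 hi (b := b) hd'
    have hi' := hi.not_gt
    exact this.imp (fun e => iff_of_true e hi) (fun e => iff_of_false e hi')
  · obtain ⟨rfl, rfl⟩ := h.eq_of_overlap h' h1 h2
    exact absurd rfl hne
  · have := isRightOf_or_of_lt h' h h2 h1 hi (b := b) hd
    have hi' := hi.not_gt
    exact this.symm.imp (fun e => iff_of_false e hi') (fun e => iff_of_true e hi)

/-- This supplies `h2` of the counting lemma: the boundary bond of a section facing another one is
not beyond that other one. -/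
theorem isRightOf_boundary_iff {i c d i' c' d' : ℤ} (h : P.NeighbouringLines i c d)
    (h' : P.NeighbouringLines i' c' d') (hd : c + 1 < d) (hd' : c' + 1 < d')
    (hne : (i, c, d) ≠ (i', c', d')) {b : ℤ × ℤ} (hb : P.HasV b.1 b.2)
    (hbc : c ≤ b.2) (hbd : b.2 ≤ d)
    (hr : P.SectionIsRightOf i c d i' c' d' → b.1 = i + 1)
    (hl : ¬ P.SectionIsRightOf i c d i' c' d' → b.1 = i) :
    P.IsRightOf i' c' d' b ↔ P.SectionIsRightOf i' c' d' i c d := by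
  by_cases h1 : d ≤ c' + 1
  · rw [sectionIsRightOf_iff_of_ge hd' hd h1]
    rw [sectionIsRightOf_iff_of_le hd hd' h1] at hr hl
    by_cases hbc' : b.2 ≤ c'
    · exact isRightOf_iff_of_ge h'.1 hbc'
    have hb2 : b.2 = d := by omega
    -- The lines interlock here: row `d` is inside the upper section and row `c'` inside the lower
    -- one, so the order of the columns fixes where both lines come from.
    have hdc : d = c' + 1 := by omega
    rw [isRightOf_iff_of_mem (by omega) (by omega)]
    obtain ⟨⟨x1, hx1, hV1⟩, ⟨x2, hx2, hV2⟩⟩ := h.exists_hasV (j := c') (by omega) (by omega)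
    obtain ⟨⟨x3, hx3, hV3⟩, ⟨x4, hx4, hV4⟩⟩ := h'.exists_hasV (j := d) (by omega) (by omega)
    by_cases hL : P.LeftLine i d
    · have e1 := hr hL
      have e2 := hL.lt hV3
      refine iff_of_false (by omega) fun hL' => ?_
      have := hL'.lt hV1
      omega
    · have e1 := hl hL
      have e2 := (h.2.2.1.rightLine hL).le hV4
      refine iff_of_true (by omega) ?_
      by_contra hL'
      have := (h'.2.1.rightLine hL').le hV2
      omega
  by_cases h2 : d' ≤ c + 1
  · rw [sectionIsRightOf_iff_of_le hd' hd h2]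
    rw [sectionIsRightOf_iff_of_ge hd hd' h2] at hr hl
    by_cases hbc' : d' ≤ b.2
    · exact isRightOf_iff_of_le h'.1 hbc'
    have hb2 : b.2 = c := by omega
    have hdc : d' = c + 1 := by omega
    rw [isRightOf_iff_of_mem (by omega) (by omega)]
    obtain ⟨⟨x1, hx1, hV1⟩, ⟨x2, hx2, hV2⟩⟩ := h.exists_hasV (j := d') (by omega) (by omega)
    obtain ⟨⟨x3, hx3, hV3⟩, ⟨x4, hx4, hV4⟩⟩ := h'.exists_hasV (j := c) (by omega) (by omega)
    by_cases hL : P.LeftLine i c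
    · have e1 := hr hL
      have e2 := hL.lt hV3
      refine iff_of_false (by omega) fun hL' => ?_
      have := hL'.lt hV1
      omega
    · have e1 := hl hL
      have e2 := (h.2.1.rightLine hL).le hV4
      refine iff_of_true (by omega) ?_
      by_contra hL'
      have := (h'.2.2.1.rightLine hL').le hV2
      omega
  push Not at h1 h2
  rw [sectionIsRightOf_iff_of_lt h2 h1]
  rw [sectionIsRightOf_iff_of_lt h1 h2] at hr hl
  have hij : i ≠ i' := by
    rintro rfl
    obtain ⟨rfl, rfl⟩ := h.eq_of_overlap h' h1 h2
    exact hne rfl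
  rcases lt_or_gt_of_ne hij with hi | hi
  · have e1 := hr hi
    refine iff_of_false ?_ (by omega)
    rintro (⟨f1, f2, f3⟩ | ⟨f1, f2⟩ | ⟨f1, f2⟩)
    · omega
    · by_cases hlt : d' < d
      · obtain ⟨⟨x, hx, hV⟩, -⟩ := h.exists_hasV (j := d') (by omega) hlt
        have := f2.lt hV
        omega
      · rw [show d' = b.2 by omega] at f2
        have := f2.lt hb
        omega
    · by_cases hlt : c < c'
      · obtain ⟨⟨x, hx, hV⟩, -⟩ := h.exists_hasV (j := c') hlt (by omega)
        have := f2.lt hV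
        omega
      · rw [show c' = b.2 by omega] at f2
        have := f2.lt hb
        omega
  · have e1 := hl (by omega)
    refine iff_of_true ?_ hi
    by_cases g1 : d' ≤ b.2
    · refine Or.inr (Or.inl ⟨g1, ?_⟩)
      by_contra hL
      have hR := h'.2.2.1.rightLine hL
      by_cases hlt : d' < d
      · obtain ⟨-, x, hx, hV⟩ := h.exists_hasV (j := d') (by omega) hlt
        have := hR.le hV
        omega
      · rw [show d' = b.2 by omega] at hR
        have := hR.le hb
        omega
    by_cases g2 : b.2 ≤ c'
    · refine Or.inr (Or.inr ⟨g2, ?_⟩)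
      by_contra hL
      have hR := h'.2.1.rightLine hL
      by_cases hlt : c < c'
      · obtain ⟨-, x, hx, hV⟩ := h.exists_hasV (j := c') hlt (by omega)
        have := hR.le hV
        omega
      · rw [show c' = b.2 by omega] at hR
        have := hR.le hb
        omega
    exact Or.inl ⟨by omega, by omega, by omega⟩

end SelfAvoidingPolygon

/-! ### At least `3k - 2` vertical bonds on each side of a large section. -/

/-- A positive `r j` with the parity of `h j` is at least 2 when `h j` is even. The term `h / 2`
collects this extra unit once for each positive even value that `h` must pass. -/
theorem add_half_le_sum_of_alternating {c : ℤ} {r h : ℤ → ℕ} (h0 : h c = 0)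
    (hstep : ∀ j, h (j + 1) ≤ h j + 1) (n : ℕ) (hr : ∀ j, c < j → j ≤ c + n → 1 ≤ r j)
    (heven : ∀ j, c < j → j ≤ c + n → Even (r j + h j)) :
    h (c + n) + h (c + n) / 2 ≤ ∑ j ∈ Finset.Ioc c (c + n), r j := by
  induction n with
  | zero => simp [h0]
  | succ n ih =>
    have ih := ih (fun j h1 h2 => hr j h1 (by push_cast; omega))
      (fun j h1 h2 => heven j h1 (by push_cast; omega))
    have e : c + ((n + 1 : ℕ) : ℤ) = c + n + 1 := by push_cast; ring
    rw [e] at hr heven ⊢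
    have hI : Finset.Ioc c (c + n + 1) = insert (c + n + 1) (Finset.Ioc c (c + n)) := by
      ext x
      simp only [Finset.mem_Ioc, Finset.mem_insert]
      omega
    rw [hI, Finset.sum_insert (by simp)]
    have e1 := hr (c + n + 1) (by omega) le_rfl
    have e2 := heven (c + n + 1) (by omega) le_rfl
    have e3 := hstep (c + n)
    rw [Nat.even_iff] at e2
    omega

namespace SelfAvoidingPolygon

variable (P : SelfAvoidingPolygon)

open Classical in
/-- The number of horizontal bonds in column `i` at the heights `c + 1, …, t`. -/
noncomputable def heightCount (i c t : ℤ) : ℕ := ((Finset.Ioc c t).filter (P.HasH i)).card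

open Classical in
theorem heightCount_add_one {i c t : ℤ} (h : c ≤ t) :
    P.heightCount i c (t + 1) = P.heightCount i c t + if P.HasH i (t + 1) then 1 else 0 := by
  have hI : Finset.Ioc c (t + 1) = insert (t + 1) (Finset.Ioc c t) := by
    ext x
    simp only [Finset.mem_Ioc, Finset.mem_insert]
    omega
  rw [heightCount, hI, Finset.filter_insert]
  split_ifs
  · rw [Finset.card_insert_of_notMem (by simp), heightCount]
  · rw [heightCount, add_zero]

theorem heightCount_self (i c : ℤ) : P.heightCount i c c = 0 := by
  simp [heightCount]

theorem heightCount_add_one_le (i c t : ℤ) :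
    P.heightCount i c (t + 1) ≤ P.heightCount i c t + 1 := by
  by_cases h : c ≤ t
  · rw [P.heightCount_add_one h]
    split_ifs <;> omega
  · rw [heightCount, Finset.Ioc_eq_empty (by omega)]
    simp

theorem encard_bondsBetween (i c d : ℤ) :
    (P.bondsBetween i c d).encard = P.heightCount i c d := by
  classical
  have : P.bondsBetween i c d = (fun y : ℤ => s((i, y), (i + 1, y))) ''
      (((Finset.Ioc c d).filter (P.HasH i) : Finset ℤ) : Set ℤ) := by
    ext e
    simp only [bondsBetween, Set.mem_ofPred_eq, Finset.coe_filter, Finset.mem_Ioc, Set.mem_image]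
    constructor
    · rintro ⟨y, h1, h2, h3, rfl⟩
      exact ⟨y, ⟨⟨h1, h2⟩, h3⟩, rfl⟩
    · rintro ⟨y, ⟨⟨h1, h2⟩, h3⟩, rfl⟩
      exact ⟨y, h1, h2, h3, rfl⟩
  rw [this, Function.Injective.encard_image, Set.encard_coe_eq_coe_finsetCard]
  · simp only [heightCount]
  · intro y y' h
    simp only [Sym2.eq_iff, Prod.mk.injEq] at h
    omega

variable {P}

theorem NeighbouringLines.even_rightCount_add_heightCount {i c d : ℤ}
    (h : P.NeighbouringLines i c d) (n : ℕ) :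
    Even (P.rightCount i (c + n) + P.heightCount i c (c + n)) := by
  induction n with
  | zero => simpa [heightCount_self] using P.even_rightCount_of_sectionLine h.2.1
  | succ n ih =>
    rw [show c + ((n + 1 : ℕ) : ℤ) = c + n + 1 by push_cast; ring]
    have h1 := P.even_rightCount_add i (c + n + 1)
    rw [add_sub_cancel_right] at h1
    rw [P.heightCount_add_one (by omega)]
    rw [Nat.even_iff] at *
    omega

/-- Row `d - 1` lies below the height `d`, so only `2k - 1` horizontal bonds are guaranteed under
it, and `(2k - 1) + (k - 1) = 3k - 2`. Leaving `r` free serves both sides. -/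
theorem NeighbouringLines.le_sum {i c d : ℤ} {k : ℕ} (h : P.NeighbouringLines i c d)
    (hk : 2 * k ≤ P.heightCount i c d) {r : ℤ → ℕ} (hr : ∀ j, c < j → j < d → 1 ≤ r j)
    (heven : ∀ j, Even (r j + P.rightCount i j)) :
    3 * k - 2 ≤ ∑ j ∈ Finset.Ioc c (d - 1), r j := by
  have hcd := h.1
  obtain ⟨n, hn⟩ : ∃ n : ℕ, d - 1 = c + n := ⟨(d - 1 - c).toNat, by omega⟩
  rw [hn]
  have key := add_half_le_sum_of_alternating (P.heightCount_self i c)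
    (P.heightCount_add_one_le i c) n (fun j h1 h2 => hr j h1 (by omega)) (fun j h1 h2 => by
      have e1 := heven j
      have e2 := h.even_rightCount_add_heightCount (j - c).toNat
      rw [show c + ((j - c).toNat : ℤ) = j by omega] at e2
      rw [Nat.even_iff] at *
      omega)
  have := P.heightCount_add_one_le i c (d - 1)
  rw [sub_add_cancel] at this
  rw [← hn] at key ⊢
  omega

theorem NeighbouringLines.le_card_right {i c d : ℤ} {k : ℕ} (h : P.NeighbouringLines i c d)
    (hk : 2 * k ≤ P.heightCount i c d) :
    3 * k - 2 ≤ (P.bondFinset.filter (fun b => c < b.2 ∧ b.2 < d ∧ i < b.1)).card := by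
  refine (h.le_sum hk (r := P.rightCount i) (fun j h1 h2 => ?_) (fun j => ⟨_, rfl⟩)).trans_eq ?_
  · rw [Nat.one_le_iff_ne_zero, Ne, rightCount_eq_zero]
    exact fun hR => h.2.2.2 j h1 h2 (Or.inr hR)
  · rw [Finset.card_eq_sum_card_fiberwise (f := Prod.snd) (t := Finset.Ioc c (d - 1))]
    · refine Finset.sum_congr rfl fun j hj => ?_
      rw [Finset.mem_Ioc] at hj
      rw [rightCount, Finset.filter_filter]
      congr 1
      refine Finset.filter_congr fun b _ => ?_
      omega
    · intro b hb
      simp only [Finset.coe_filter, Set.mem_ofPred_eq] at hb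
      simp only [Finset.coe_Ioc, Set.mem_Ioc]
      omega

theorem NeighbouringLines.le_card_left {i c d : ℤ} {k : ℕ} (h : P.NeighbouringLines i c d)
    (hk : 2 * k ≤ P.heightCount i c d) :
    3 * k - 2 ≤ (P.bondFinset.filter (fun b => c < b.2 ∧ b.2 < d ∧ b.1 ≤ i)).card := by
  refine (h.le_sum hk (r := P.leftCount i) (fun j h1 h2 => ?_) (fun j => ?_)).trans_eq ?_
  · rw [Nat.one_le_iff_ne_zero, Ne, leftCount_eq_zero]
    exact fun hR => h.2.2.2 j h1 h2 (Or.inl hR)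
  · rw [leftCount_add_rightCount]
    exact P.even_card_row j
  · rw [Finset.card_eq_sum_card_fiberwise (f := Prod.snd) (t := Finset.Ioc c (d - 1))]
    · refine Finset.sum_congr rfl fun j hj => ?_
      rw [Finset.mem_Ioc] at hj
      rw [leftCount, Finset.filter_filter]
      congr 1
      refine Finset.filter_congr fun b _ => ?_
      omega
    · intro b hb
      simp only [Finset.coe_filter, Set.mem_ofPred_eq] at hb
      simp only [Finset.coe_Ioc, Set.mem_Ioc]
      omega

/-! ### Boundary bonds in the absence of duplicates. -/

theorem hasH_sub_one_iff_of_not_hasV {x y : ℤ} (h1 : ¬ P.HasV x (y - 1)) (h2 : ¬ P.HasV x y) :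
    P.HasH (x - 1) y ↔ P.HasH x y := by
  have := (P.degree_sum x y).1
  rw [if_neg h1, if_neg h2] at this
  by_cases e1 : P.HasH (x - 1) y <;> by_cases e2 : P.HasH x y <;> simp [e1, e2] at this ⊢

theorem sectionLine_sub_one_iff_of_not_hasV {x j : ℤ} (h : ¬ P.HasV x j) :
    P.SectionLine (x - 1) j ↔ P.SectionLine x j := by
  have e1 : P.LeftLine (x - 1) j ↔ P.LeftLine x j := by
    refine ⟨fun hL z hz => ?_, fun hL z hz => hL z (by omega)⟩
    rcases eq_or_ne z x with rfl | hne
    · exact h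
    · exact hL z (by omega)
  have e2 : P.RightLine (x - 1) j ↔ P.RightLine x j := by
    refine ⟨fun hR z hz => hR z (by omega), fun hR z hz => ?_⟩
    rcases eq_or_ne z x with rfl | hne
    · exact h
    · exact hR z (by omega)
  rw [SectionLine, SectionLine, e1, e2]

theorem neighbouringLines_sub_one_iff_of_not_hasV {x c d : ℤ}
    (h : ∀ j, c ≤ j → j ≤ d → ¬ P.HasV x j) :
    P.NeighbouringLines (x - 1) c d ↔ P.NeighbouringLines x c d := by
  unfold NeighbouringLines
  refine and_congr_right fun hcd => ?_
  rw [sectionLine_sub_one_iff_of_not_hasV (h c le_rfl hcd.le),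
    sectionLine_sub_one_iff_of_not_hasV (h d hcd.le le_rfl)]
  refine and_congr_right fun _ => and_congr_right fun _ => ?_
  refine forall_congr' fun j => forall_congr' fun h1 => forall_congr' fun h2 => ?_
  rw [sectionLine_sub_one_iff_of_not_hasV (h j h1.le h2.le)]

/-- Otherwise all section lines and horizontal bonds continue unchanged into column `i - 1`, and the
section is a duplicate. -/
theorem exists_hasV_left {i c d : ℤ} (hmin : ∀ i c d, ¬ P.IsDuplicate i c d)
    (h : P.NeighbouringLines i c d) (hne : (P.bondsBetween i c d).Nonempty) :
    ∃ j, c ≤ j ∧ j ≤ d ∧ P.HasV i j := by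
  by_contra hcon
  push Not at hcon
  exact hmin i c d ⟨h, hne, (neighbouringLines_sub_one_iff_of_not_hasV hcon).2 h, fun y h1 h2 =>
    hasH_sub_one_iff_of_not_hasV (hcon _ (by omega) (by omega)) (hcon _ (by omega) (by omega))⟩

/-- Here the duplicate would be the section in column `i + 1`. -/
theorem exists_hasV_right {i c d : ℤ} (hmin : ∀ i c d, ¬ P.IsDuplicate i c d)
    (h : P.NeighbouringLines i c d) (hne : (P.bondsBetween i c d).Nonempty) :
    ∃ j, c ≤ j ∧ j ≤ d ∧ P.HasV (i + 1) j := by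
  by_contra hcon
  push Not at hcon
  have hi : i + 1 - 1 = i := by ring
  have hH : ∀ y, c < y → y ≤ d → (P.HasH (i + 1 - 1) y ↔ P.HasH (i + 1) y) := fun y h1 h2 =>
    hasH_sub_one_iff_of_not_hasV (hcon _ (by omega) (by omega)) (hcon _ (by omega) (by omega))
  refine hmin (i + 1) c d ⟨?_, ?_, by rwa [hi], hH⟩
  · rwa [← neighbouringLines_sub_one_iff_of_not_hasV hcon, hi]
  · obtain ⟨_, y, h1, h2, h3, -⟩ := hne
    exact ⟨_, y, h1, h2, (hH y h1 h2).1 (by rwa [hi]), rfl⟩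

theorem encard_sections_le {k M : ℕ} (hk : 1 ≤ k) (hmin : ∀ i c d, ¬ P.IsDuplicate i c d)
    (hV : P.verticalBonds.ncard + 4 = 6 * k + 2 * M) :
    {S : Set (Sym2 (ℤ × ℤ)) | P.IsSection S ∧ ((2 * k : ℕ) : ℕ∞) ≤ S.encard}.encard
      ≤ ((2 * M + 1 : ℕ) : ℕ∞) := by
  classical
  by_contra hcon
  rw [not_le] at hcon
  -- Exactly `2M + 2` sections are kept, which avoids proving beforehand that the family is finite.
  obtain ⟨T, hT, hTc⟩ := Set.exists_subset_encard_eq (Order.add_one_le_of_lt hcon)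
  have hTfin : T.Finite := by
    rw [← Set.encard_lt_top_iff, hTc]
    exact_mod_cast ENat.natCast_lt_top (2 * M + 1 + 1)
  have hTcard : hTfin.toFinset.card = 2 * M + 2 := by
    rw [hTfin.encard_eq_coe_toFinset_card] at hTc
    exact_mod_cast hTc
  have hsec : ∀ S : Set (Sym2 (ℤ × ℤ)), ∃ t : ℤ × ℤ × ℤ, S ∈ T →
      P.NeighbouringLines t.1 t.2.1 t.2.2 ∧ S = P.bondsBetween t.1 t.2.1 t.2.2 := by
    intro S
    by_cases hS : S ∈ T
    · obtain ⟨⟨-, i, c, d, h⟩, -⟩ := hT hS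
      exact ⟨(i, c, d), fun _ => h⟩
    · exact ⟨0, fun h => absurd h hS⟩
  choose t ht using hsec
  have hN := fun S hS => (ht S hS).1
  have hinj : ∀ S ∈ T, ∀ S' ∈ T, S ≠ S' →
      ((t S).1, (t S).2.1, (t S).2.2) ≠ ((t S').1, (t S').2.1, (t S').2.2) := by
    intro S hS S' hS' hne heq
    simp only [Prod.mk.injEq] at heq
    rw [(ht S hS).2, (ht S' hS').2, heq.1, heq.2.1, heq.2.2] at hne
    exact hne rfl
  have hcount : ∀ S ∈ T, 2 * k ≤ P.heightCount (t S).1 (t S).2.1 (t S).2.2 := by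
    intro S hS
    have := (hT hS).2
    rw [(ht S hS).2, encard_bondsBetween] at this
    exact_mod_cast this
  -- Two horizontal bonds, available since `k ≥ 1`, force a row strictly between the lines.
  have hlt : ∀ S ∈ T, (t S).2.1 + 1 < (t S).2.2 := by
    intro S hS
    have h1 := hcount S hS
    have h2 : P.heightCount (t S).1 (t S).2.1 (t S).2.2 ≤ (Finset.Ioc (t S).2.1 (t S).2.2).card :=
      Finset.card_filter_le _ _
    rw [Int.card_Ioc] at h2
    omega
  have hnonempty : ∀ S ∈ T, (P.bondsBetween (t S).1 (t S).2.1 (t S).2.2).Nonempty := by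
    intro S hS
    rw [← (ht S hS).2]
    exact (hT hS).1.1
  have hbd : ∀ (S : Set (Sym2 (ℤ × ℤ))) (β : Bool), ∃ j, S ∈ T →
      (t S).2.1 ≤ j ∧ j ≤ (t S).2.2 ∧ P.HasV (if β then (t S).1 + 1 else (t S).1) j := by
    intro S β
    by_cases hS : S ∈ T
    · cases β
      · obtain ⟨j, hj⟩ := exists_hasV_left hmin (hN S hS) (hnonempty S hS)
        exact ⟨j, fun _ => hj⟩
      · obtain ⟨j, hj⟩ := exists_hasV_right hmin (hN S hS) (hnonempty S hS)
        exact ⟨j, fun _ => hj⟩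
    · exact ⟨0, fun h => absurd h hS⟩
  choose y hy using hbd
  set bd : Set (Sym2 (ℤ × ℤ)) → Bool → ℤ × ℤ := fun S β =>
    (if β then (t S).1 + 1 else (t S).1, y S β) with hbd_def
  set R : Set (Sym2 (ℤ × ℤ)) → ℤ × ℤ → Prop := fun S b =>
    P.IsRightOf (t S).1 (t S).2.1 (t S).2.2 b with hR
  set A : Set (Sym2 (ℤ × ℤ)) → Bool → Finset (ℤ × ℤ) := fun S β =>
    P.bondFinset.filter (fun b => R S b ↔ β = true) with hA
  set side : Set (Sym2 (ℤ × ℤ)) → Set (Sym2 (ℤ × ℤ)) → Bool := fun S S' =>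
    decide (P.SectionIsRightOf (t S).1 (t S).2.1 (t S).2.2 (t S').1 (t S').2.1 (t S').2.2)
    with hside
  have key := two_mul_add_card_le_of_laminar hTfin.toFinset
    (Finset.card_pos.1 (by omega)) P.bondFinset A bd side (3 * k - 2)
    (fun S _ β => Finset.filter_subset _ _)
    (by
      intro S _ β
      rw [Finset.disjoint_left]
      intro b h1 h2
      rw [hA, Finset.mem_filter] at h1 h2
      have := h1.2.symm.trans h2.2
      cases β <;> simp at this)
    (by
      intro S _ β b hb
      simp only [hA, Finset.mem_filter]
      by_cases h : R S b <;> cases β <;> simp [h, hb])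
    (by
      intro S hS β
      rw [Set.Finite.mem_toFinset] at hS
      obtain ⟨h1, h2, h3⟩ := hy S β hS
      simp only [hA, Finset.mem_filter, mem_bondFinset]
      refine ⟨h3, ?_⟩
      have hl := hlt S hS
      have hNS := hN S hS
      cases β
      · simp only [Bool.false_eq_true, if_false, iff_false, hR, hbd_def] at h3 ⊢
        rintro (⟨-, -, e⟩ | ⟨e, e'⟩ | ⟨e, e'⟩)
        · simp only at e
          omega
        · simp only at e
          have := e'.lt (show P.HasV _ (t S).2.2 from (show y S false = (t S).2.2 by omega) ▸ h3)
          omega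
        · simp only at e
          have := e'.lt (show P.HasV _ (t S).2.1 from (show y S false = (t S).2.1 by omega) ▸ h3)
          omega
      · simp only [if_true, iff_true, hR, hbd_def] at h3 ⊢
        rcases eq_or_ne (y S true) (t S).2.1 with e | e
        · refine Or.inr (Or.inr ⟨e.le, ?_⟩)
          by_contra hL
          have := (hNS.2.1.rightLine hL).le (e ▸ h3)
          omega
        rcases eq_or_ne (y S true) (t S).2.2 with e' | e'
        · refine Or.inr (Or.inl ⟨e'.ge, ?_⟩)
          by_contra hL
          have := (hNS.2.2.1.rightLine hL).le (e' ▸ h3)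
          omega
        · refine Or.inl ⟨?_, ?_, ?_⟩ <;> simp only <;> omega)
    (by
      intro S hS S' hS' hne
      rw [Set.Finite.mem_toFinset] at hS hS'
      rw [Finset.disjoint_left]
      intro b h1 h2
      simp only [hA, Finset.mem_filter, mem_bondFinset, hside, hR, Bool.not_eq_true',
        decide_eq_false_iff_not] at h1 h2
      have := isRightOf_iff_or_isRightOf_iff (hN S hS) (hN S' hS') (hlt S hS) (hlt S' hS')
        (hinj S hS S' hS' hne) (b := b)
      tauto)
    (by
      intro S hS S' hS' hne hmem
      rw [Set.Finite.mem_toFinset] at hS hS'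
      obtain ⟨h1, h2, h3⟩ := hy S (side S S') hS
      have := isRightOf_boundary_iff (hN S hS) (hN S' hS') (hlt S hS) (hlt S' hS')
        (hinj S hS S' hS' hne) (b := bd S (side S S')) h3 h1 h2
        (fun h => if_pos (decide_eq_true h))
        (fun h => if_neg (by simpa [hside] using h))
      simp only [hA, Finset.mem_filter, mem_bondFinset, hR] at hmem
      have h4 := hmem.2
      rw [Bool.not_eq_true', this] at h4
      simp only [hside, decide_eq_false_iff_not] at h4
      tauto)
    (by
      intro S hS β
      rw [Set.Finite.mem_toFinset] at hS
      have hl := hlt S hS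
      cases β
      · refine ((hN S hS).le_card_left (hcount S hS)).trans (Finset.card_le_card ?_)
        intro b hb
        rw [Finset.mem_filter] at hb
        simp only [hA, hR, Finset.mem_filter, Bool.false_eq_true, iff_false]
        refine ⟨hb.1, ?_⟩
        rw [isRightOf_iff_of_mem hb.2.1 hb.2.2.1]
        omega
      · refine ((hN S hS).le_card_right (hcount S hS)).trans (Finset.card_le_card ?_)
        intro b hb
        rw [Finset.mem_filter] at hb
        simp only [hA, hR, Finset.mem_filter, iff_true]
        refine ⟨hb.1, ?_⟩
        rw [isRightOf_iff_of_mem hb.2.1 hb.2.2.1]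
        omega)
  -- The contradiction is `2(3k - 2) + (2M + 2) ≤ (6k - 4 + 2M) + 1`.
  rw [ncard_verticalBonds] at hV
  omega

end SelfAvoidingPolygon

/-! ### Deleting a duplicate section yields a polygon. -/

namespace SelfAvoidingPolygon

variable {P : SelfAvoidingPolygon}

theorem not_hasV_of_sectionLine {i j : ℤ} (h : P.SectionLine i j) (h' : P.SectionLine (i - 1) j) :
    ¬ P.HasV i j := by
  intro hV
  have e1 := P.even_rightCount_of_sectionLine h
  have e2 := P.even_rightCount_of_sectionLine h'
  rw [rightCount_sub_one, if_pos hV] at e2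
  rw [Nat.even_iff] at e1 e2
  omega

/-- Row `c` carries section lines in both columns. Going up, the two horizontal bonds at `(i, y)`
are both present or both absent, so by parity of the degree a vertical bond cannot start there. -/
theorem IsDuplicate.not_hasV {i c d : ℤ} (h : P.IsDuplicate i c d) {j : ℤ} (hc : c ≤ j)
    (hd : j ≤ d) : ¬ P.HasV i j := by
  obtain ⟨h1, -, h2, hH⟩ := h
  have key : ∀ n : ℕ, c + n ≤ d → ¬ P.HasV i (c + n) := by
    intro n
    induction n with
    | zero =>
      intro _
      simpa using not_hasV_of_sectionLine h1.2.1 h2.2.1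
    | succ n ih =>
      intro hn
      push_cast at hn ⊢
      rw [← add_assoc] at hn ⊢
      have e := (P.degree_sum i (c + n + 1)).1
      rw [add_sub_cancel_right, if_neg (ih (by omega))] at e
      have e' := hH (c + n + 1) (by omega) hn
      intro hV
      rw [if_pos hV] at e
      by_cases hh : P.HasH i (c + n + 1)
      · rw [if_pos hh, if_pos (e'.2 hh)] at e
        omega
      · rw [if_neg hh, if_neg (fun h => hh (e'.1 h))] at e
        omega
  have := key (j - c).toNat
  rw [show c + ((j - c).toNat : ℤ) = j by omega] at this
  exact this hd

theorem IsDuplicate.hasH {i c d : ℤ} (h : P.IsDuplicate i c d) {y : ℤ} (hc : c < y)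
    (hd : y ≤ d) (hv : (i, y) ∈ P.graph.verts) : P.HasH (i - 1) y ∧ P.HasH i y := by
  have e := (P.degree_sum i y).2 hv
  rw [if_neg (h.not_hasV (by omega) (by omega)), if_neg (h.not_hasV (by omega) hd)] at e
  by_cases h1 : P.HasH (i - 1) y <;> by_cases h2 : P.HasH i y <;> simp [h1, h2] at e ⊢

theorem adj_cases {u v : ℤ × ℤ} (h : P.graph.Adj u v) :
    (∃ x y, P.HasH x y ∧ (u = (x, y) ∧ v = (x + 1, y) ∨ u = (x + 1, y) ∧ v = (x, y))) ∨
    ∃ x y, P.HasV x y ∧ (u = (x, y) ∧ v = (x, y + 1) ∨ u = (x, y + 1) ∧ v = (x, y)) := by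
  obtain ⟨a, b⟩ := u
  obtain ⟨a', b'⟩ := v
  have := P.graph.adj_sub h
  simp only [squareLattice] at this
  rcases this with ⟨rfl, h2⟩ | ⟨rfl, h2⟩ <;> rw [abs_eq (by norm_num)] at h2 <;>
    rcases h2 with h2 | h2
  · obtain rfl : a = a' + 1 := by omega
    exact Or.inl ⟨a', b, h.symm, Or.inr ⟨rfl, rfl⟩⟩
  · obtain rfl : a' = a + 1 := by omega
    exact Or.inl ⟨a, b, h, Or.inl ⟨rfl, rfl⟩⟩
  · obtain rfl : b = b' + 1 := by omega
    exact Or.inr ⟨a, b', h.symm, Or.inr ⟨rfl, rfl⟩⟩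
  · obtain rfl : b' = b + 1 := by omega
    exact Or.inr ⟨a, b, h, Or.inl ⟨rfl, rfl⟩⟩

theorem inRightPiece_of_mem {i c d : ℤ} {v : ℤ × ℤ} (hc : c < v.2) (hd : v.2 ≤ d) :
    P.InRightPiece i c d v ↔ i + 1 ≤ v.1 := by
  constructor
  · rintro (h | h | h)
    · exact h.2.2
    · omega
    · omega
  · exact fun h => Or.inl ⟨hc, hd, h⟩

theorem inRightPiece_of_lt {i c d : ℤ} (hcd : c < d) {v : ℤ × ℤ} (hd : d < v.2) :
    P.InRightPiece i c d v ↔ P.LeftLine i d := by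
  constructor
  · rintro (h | h | h)
    · omega
    · exact h.2
    · omega
  · exact fun h => Or.inr (Or.inl ⟨hd, h⟩)

theorem inRightPiece_of_le {i c d : ℤ} (hcd : c < d) {v : ℤ × ℤ} (hc : v.2 ≤ c) :
    P.InRightPiece i c d v ↔ P.LeftLine i c := by
  constructor
  · rintro (h | h | h)
    · omega
    · omega
    · exact h.2
  · exact fun h => Or.inr (Or.inr ⟨hc, h⟩)

theorem SectionLine.leftLine_iff {i j x : ℤ} (h : P.SectionLine i j) (hV : P.HasV x j) :
    P.LeftLine i j ↔ i + 1 ≤ x := by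
  constructor
  · intro hL
    by_contra hx
    exact hL x (by omega) hV
  · intro hx
    exact h.resolve_right fun hR => hR x hx hV

/-- No vertical bond is torn: in row `c` or `d` it is to the right of the column exactly when the
section line there comes from the left. -/
theorem inRightPiece_vertical {i c d : ℤ} (h : P.NeighbouringLines i c d) {x j : ℤ}
    (hV : P.HasV x j) : P.InRightPiece i c d (x, j) ↔ P.InRightPiece i c d (x, j + 1) := by
  have hcd := h.1
  rcases lt_trichotomy j c with h1 | rfl | h1
  · rw [inRightPiece_of_le hcd h1.le, inRightPiece_of_le hcd (by simp only; omega)]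
  · rw [inRightPiece_of_le hcd le_rfl, inRightPiece_of_mem (by simp only; omega)
      (by simp only; omega), h.2.1.leftLine_iff hV]
  rcases lt_trichotomy j d with h2 | rfl | h2
  · rw [inRightPiece_of_mem h1 h2.le, inRightPiece_of_mem (by simp only; omega)
      (by simp only; omega)]
  · rw [inRightPiece_of_mem (v := (x, j)) h1 le_rfl, inRightPiece_of_lt hcd (by simp only; omega),
      h.2.2.1.leftLine_iff hV]
  · rw [inRightPiece_of_lt hcd h2, inRightPiece_of_lt hcd (by simp only; omega)]

theorem inRightPiece_horizontal {i c d : ℤ} (hcd : c < d) (x y : ℤ) :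
    (P.InRightPiece i c d (x, y) ↔ P.InRightPiece i c d (x + 1, y)) ∨
      (x = i ∧ c < y ∧ y ≤ d) := by
  by_cases h1 : y ≤ c
  · exact Or.inl (by rw [inRightPiece_of_le hcd h1, inRightPiece_of_le hcd h1])
  by_cases h2 : d < y
  · exact Or.inl (by rw [inRightPiece_of_lt hcd h2, inRightPiece_of_lt hcd h2])
  by_cases h3 : x = i
  · exact Or.inr ⟨h3, by omega, by omega⟩
  · left
    rw [inRightPiece_of_mem (by simp only; omega) (by simp only; omega),
      inRightPiece_of_mem (by simp only; omega) (by simp only; omega)]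
    simp only
    omega

theorem close_of_inRightPiece {i c d : ℤ} {v : ℤ × ℤ} (h : P.InRightPiece i c d v) :
    P.close i c d v = (v.1 - 1, v.2) := if_pos h

theorem close_of_not_inRightPiece {i c d : ℤ} {v : ℤ × ℤ} (h : ¬ P.InRightPiece i c d v) :
    P.close i c d v = v := if_neg h

theorem close_eq_of_mem {i c d x y : ℤ} (hc : c < y) (hd : y ≤ d) :
    P.close i c d (x, y) = if i + 1 ≤ x then (x - 1, y) else (x, y) := by
  have hiff := P.inRightPiece_of_mem (i := i) (v := (x, y)) hc hd
  split_ifs with h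
  · exact close_of_inRightPiece (hiff.2 h)
  · exact close_of_not_inRightPiece (mt hiff.1 h)

theorem close_snd {i c d : ℤ} (v : ℤ × ℤ) : (P.close i c d v).2 = v.2 := by
  unfold close
  split_ifs <;> rfl

theorem adj_close {i c d : ℤ} (h : P.NeighbouringLines i c d) {u v : ℤ × ℤ}
    (huv : P.graph.Adj u v) (hne : P.close i c d u ≠ P.close i c d v) :
    squareLattice.Adj (P.close i c d u) (P.close i c d v) := by
  have key : (P.InRightPiece i c d u ↔ P.InRightPiece i c d v) →
      squareLattice.Adj (P.close i c d u) (P.close i c d v) := by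
    intro hiff
    have := P.graph.adj_sub huv
    by_cases hu : P.InRightPiece i c d u
    · rw [close_of_inRightPiece hu, close_of_inRightPiece (hiff.1 hu)]
      simpa [squareLattice] using this
    · rw [close_of_not_inRightPiece hu, close_of_not_inRightPiece (mt hiff.2 hu)]
      exact this
  rcases adj_cases huv with ⟨x, y, hH, ⟨rfl, rfl⟩ | ⟨rfl, rfl⟩⟩ | ⟨x, y, hV, ⟨rfl, rfl⟩ | ⟨rfl, rfl⟩⟩
  · rcases P.inRightPiece_horizontal (i := i) h.1 x y with e | ⟨rfl, h1, h2⟩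
    · exact key e
    · rw [close_eq_of_mem h1 h2, close_eq_of_mem h1 h2] at hne
      simp at hne
  · rcases P.inRightPiece_horizontal (i := i) h.1 x y with e | ⟨rfl, h1, h2⟩
    · exact key e.symm
    · rw [close_eq_of_mem h1 h2, close_eq_of_mem h1 h2] at hne
      simp at hne
  · exact key (inRightPiece_vertical h hV)
  · exact key (inRightPiece_vertical h hV).symm

theorem close_eq_close {i c d : ℤ} (hcd : c < d) {u v : ℤ × ℤ} (hne : u ≠ v)
    (h : P.close i c d u = P.close i c d v) :
    ∃ y, c < y ∧ y ≤ d ∧ ((u = (i, y) ∧ v = (i + 1, y)) ∨ (u = (i + 1, y) ∧ v = (i, y))) := by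
  obtain ⟨a, y⟩ := u
  obtain ⟨b, y'⟩ := v
  obtain rfl : y = y' := by
    have := congrArg Prod.snd h
    rwa [close_snd, close_snd] at this
  have key : ¬ (P.InRightPiece i c d (a, y) ↔ P.InRightPiece i c d (b, y)) := by
    intro hiff
    by_cases hu : P.InRightPiece i c d (a, y)
    · rw [close_of_inRightPiece hu, close_of_inRightPiece (hiff.1 hu)] at h
      simp only [Prod.mk.injEq, and_true, sub_left_inj] at h
      exact hne (by rw [h])
    · rw [close_of_not_inRightPiece hu, close_of_not_inRightPiece (mt hiff.2 hu)] at h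
      exact hne h
  have h1 : c < y := by
    by_contra h1
    exact key (by rw [inRightPiece_of_le hcd (by simp only; omega),
      inRightPiece_of_le hcd (by simp only; omega)])
  have h2 : y ≤ d := by
    by_contra h2
    exact key (by rw [inRightPiece_of_lt hcd (by simp only; omega),
      inRightPiece_of_lt hcd (by simp only; omega)])
  refine ⟨y, h1, h2, ?_⟩
  rw [close_eq_of_mem h1 h2, close_eq_of_mem h1 h2] at h
  simp only [Prod.mk.injEq, ne_eq, and_true] at hne ⊢
  split_ifs at h <;> simp only [Prod.mk.injEq, and_true] at h <;> omega

/-- The subgraph obtained from `P` by the deletion of a duplicate section. -/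
noncomputable def deletionGraph {i c d : ℤ} (h : P.NeighbouringLines i c d) :
    squareLattice.Subgraph where
  verts := P.close i c d '' P.graph.verts
  Adj u v := u ≠ v ∧ ∃ u' v', P.graph.Adj u' v' ∧ P.close i c d u' = u ∧ P.close i c d v' = v
  adj_sub := by
    rintro u v ⟨hne, u', v', h', rfl, rfl⟩
    exact adj_close h h' hne
  edge_vert := by
    rintro u v ⟨-, u', v', h', rfl, rfl⟩
    exact ⟨u', P.graph.edge_vert h', rfl⟩
  symm := ⟨by
    rintro u v ⟨hne, u', v', h', e1, e2⟩
    exact ⟨hne.symm, v', u', h'.symm, e2, e1⟩⟩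

theorem deletionGraph_connected {i c d : ℤ} (h : P.NeighbouringLines i c d) :
    (deletionGraph h).Connected := by
  have hc := P.connected
  rw [SimpleGraph.Subgraph.connected_iff'] at hc ⊢
  have key : ∀ u v : P.graph.verts, P.graph.coe.Reachable u v →
      (deletionGraph h).coe.Reachable ⟨_, Set.mem_image_of_mem _ u.2⟩
        ⟨_, Set.mem_image_of_mem _ v.2⟩ := by
    rintro u v ⟨p⟩
    induction p with
    | nil => exact SimpleGraph.Reachable.refl _
    | @cons a b e hab _ ih =>
      refine SimpleGraph.Reachable.trans ?_ ih
      by_cases heq : P.close i c d a = P.close i c d b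
      · simp only [heq]
        exact SimpleGraph.Reachable.refl _
      · exact SimpleGraph.Adj.reachable
          (show (deletionGraph h).Adj _ _ from ⟨heq, _, _, hab, rfl, rfl⟩)
  obtain ⟨hpre, ⟨v⟩⟩ := (SimpleGraph.connected_iff _).1 hc
  rw [SimpleGraph.connected_iff]
  refine ⟨?_, ⟨⟨_, Set.mem_image_of_mem _ v.2⟩⟩⟩
  rintro ⟨_, u, hu, rfl⟩ ⟨_, w, hw, rfl⟩
  exact key ⟨u, hu⟩ ⟨w, hw⟩ (hpre _ _)

theorem not_adj_both {x y : ℤ} {v : ℤ × ℤ} (h1 : P.graph.Adj v (x, y))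
    (h2 : P.graph.Adj v (x + 1, y)) : False := by
  have e1 := P.graph.adj_sub h1
  have e2 := P.graph.adj_sub h2
  simp only [squareLattice] at e1 e2
  rw [abs_eq (by norm_num), abs_eq (by norm_num)] at e1 e2
  omega

/-- The site `(i, y)` has only its two horizontal bonds. Merging it with `(i + 1, y)` replaces the
bond between them by the bond to the other neighbour `z` of `(i + 1, y)`, whose image is a new site.
-/
theorem deletionGraph_degree_merged {i c d y : ℤ} (h : P.IsDuplicate i c d) (hc : c < y)
    (hd : y ≤ d) (hv : (i, y) ∈ P.graph.verts) :
    ((deletionGraph h.1).neighborSet (i, y)).ncard = 2 := by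
  obtain ⟨hH1, hH2⟩ := h.hasH hc hd hv
  rw [HasH, sub_add_cancel] at hH1
  have ha : P.close i c d (i, y) = (i, y) := by
    rw [close_eq_of_mem hc hd, if_neg (by omega)]
  have hb : P.close i c d (i + 1, y) = (i, y) := by
    rw [close_eq_of_mem hc hd, if_pos le_rfl, add_sub_cancel_right]
  have ha' : P.close i c d (i - 1, y) = (i - 1, y) := by
    rw [close_eq_of_mem hc hd, if_neg (by omega)]
  have hNa : P.graph.neighborSet (i, y) = {(i - 1, y), (i + 1, y)} := by
    symm
    refine Set.eq_of_subset_of_ncard_le ?_ ?_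
      (Set.finite_of_ncard_pos (by rw [P.degree_two _ hv]; norm_num))
    · rintro w (rfl | rfl)
      · exact hH1.symm
      · exact hH2
    · rw [P.degree_two _ hv, Set.ncard_pair (by simp only [ne_eq, Prod.mk.injEq]; omega)]
  obtain ⟨z, hz, hNb⟩ : ∃ z, z ≠ (i, y) ∧ P.graph.neighborSet (i + 1, y) = {(i, y), z} := by
    obtain ⟨p, q, hpq, hN⟩ := Set.ncard_eq_two.1 (P.degree_two _ (P.graph.edge_vert hH2.symm))
    have : (i, y) ∈ P.graph.neighborSet (i + 1, y) := hH2.symm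
    rw [hN] at this
    rcases this with rfl | h'
    · exact ⟨q, hpq.symm, hN⟩
    · obtain rfl : (i, y) = q := h'
      exact ⟨p, hpq, by rw [hN, Set.pair_comm]⟩
  have hbz : P.graph.Adj (i + 1, y) z := by
    change z ∈ P.graph.neighborSet (i + 1, y)
    rw [hNb]
    exact Or.inr rfl
  have hcz : P.close i c d z ≠ (i, y) := by
    rw [← hb]
    intro heq
    obtain ⟨y', -, -, ⟨e1, e2⟩ | ⟨e1, -⟩⟩ := close_eq_close h.1.1 (P.graph.adj_sub hbz).ne' heq
    · simp only [Prod.mk.injEq, true_and] at e2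
      rw [← e2] at e1
      exact hz e1
    · rw [e1] at hbz
      have := P.graph.adj_sub hbz
      simp only [squareLattice] at this
      rw [abs_eq (by norm_num), abs_eq (by norm_num)] at this
      obtain ⟨e2, e3⟩ | ⟨e2, e3⟩ := this
      · omega
      · have := congrArg Prod.snd heq
        rw [close_snd, close_snd, e1] at this
        simp only at this
        omega
  have hcz' : P.close i c d z ≠ (i - 1, y) := by
    rw [← ha']
    intro heq
    have hzne : z ≠ (i - 1, y) := by
      rintro rfl
      have := P.graph.adj_sub hbz
      simp only [squareLattice] at this
      rw [abs_eq (by norm_num), abs_eq (by norm_num)] at this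
      omega
    obtain ⟨y', -, -, ⟨-, e2⟩ | ⟨-, e2⟩⟩ := close_eq_close h.1.1 hzne heq
    · simp only [Prod.mk.injEq] at e2
      omega
    · simp only [Prod.mk.injEq] at e2
      omega
  have hN : (deletionGraph h.1).neighborSet (i, y) = {(i - 1, y), P.close i c d z} := by
    ext w
    constructor
    · rintro ⟨hne, u', v', hadj, e1, rfl⟩
      have hu' : u' = (i, y) ∨ u' = (i + 1, y) := by
        by_cases hu : u' = (i, y)
        · exact Or.inl hu
        · obtain ⟨y', -, -, ⟨-, e3⟩ | ⟨e2, e3⟩⟩ := close_eq_close h.1.1 hu (e1.trans ha.symm)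
          · simp only [Prod.mk.injEq] at e3
            omega
          · simp only [Prod.mk.injEq, true_and] at e3
            exact Or.inr (by rw [e2, e3])
      rcases hu' with rfl | rfl
      · have hm : v' ∈ P.graph.neighborSet (i, y) := hadj
        rw [hNa] at hm
        rcases hm with rfl | hm
        · exact Or.inl ha'
        · obtain rfl : v' = (i + 1, y) := hm
          exact absurd hb.symm hne
      · have hm : v' ∈ P.graph.neighborSet (i + 1, y) := hadj
        rw [hNb] at hm
        rcases hm with rfl | hm
        · exact absurd ha.symm hne
        · obtain rfl : v' = z := hm
          exact Or.inr rfl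
    · rintro (rfl | hw)
      · exact ⟨by simp only [ne_eq, Prod.mk.injEq]; omega, _, _, hH1.symm, ha, ha'⟩
      · obtain rfl : w = P.close i c d z := hw
        exact ⟨hcz.symm, _, _, hbz, hb, rfl⟩
  rw [hN, Set.ncard_pair hcz'.symm]

theorem deletionGraph_degree {i c d : ℤ} (h : P.IsDuplicate i c d) {w : ℤ × ℤ}
    (hw : w ∈ (deletionGraph h.1).verts) :
    ((deletionGraph h.1).neighborSet w).ncard = 2 := by
  obtain ⟨v, hv, rfl⟩ := hw
  by_cases hex : ∃ v' ∈ P.graph.verts, v' ≠ v ∧ P.close i c d v' = P.close i c d v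
  · obtain ⟨v', hv', hne, heq⟩ := hex
    obtain ⟨y, h1, h2, ⟨rfl, rfl⟩ | ⟨rfl, rfl⟩⟩ := close_eq_close h.1.1 hne heq
    · rw [close_eq_of_mem h1 h2, if_pos le_rfl, add_sub_cancel_right]
      exact deletionGraph_degree_merged h h1 h2 hv'
    · rw [close_eq_of_mem h1 h2, if_neg (by omega)]
      exact deletionGraph_degree_merged h h1 h2 hv
  · push Not at hex
    have hN : (deletionGraph h.1).neighborSet (P.close i c d v) =
        P.close i c d '' P.graph.neighborSet v := by
      ext w
      constructor
      · rintro ⟨hne, u', v', hadj, e1, rfl⟩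
        have : u' = v := by
          by_contra hne'
          exact hex u' (P.graph.edge_vert hadj) hne' e1
        subst this
        exact ⟨v', hadj, rfl⟩
      · rintro ⟨v', hadj, rfl⟩
        refine ⟨fun heq => ?_, v, v', hadj, rfl, rfl⟩
        exact hex v' (P.graph.edge_vert hadj.symm) (P.graph.adj_sub hadj).ne' heq.symm
    rw [hN, Set.InjOn.ncard_image, P.degree_two _ hv]
    -- Two neighbours of `v` with the same image would be adjacent sites, but the lattice has no
    -- triangle.
    intro p hp q hq heq
    by_contra hne
    obtain ⟨y, -, -, ⟨rfl, rfl⟩ | ⟨rfl, rfl⟩⟩ := close_eq_close h.1.1 hne heq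
    · exact not_adj_both hp hq
    · exact not_adj_both hq hp

/-- The polygon obtained from `P` by the deletion of a duplicate section. -/
noncomputable def deletion {i c d : ℤ} (h : P.IsDuplicate i c d) : SelfAvoidingPolygon where
  graph := deletionGraph h.1
  finite_verts := P.finite_verts.image _
  connected := deletionGraph_connected h.1
  degree_two _ hv := deletionGraph_degree h hv

theorem deletesTo_deletion {i c d : ℤ} (h : P.IsDuplicate i c d) : P.DeletesTo (deletion h) :=
  ⟨i, c, d, h, rfl, fun _ _ => Iff.rfl⟩

/-- The ends of a deleted horizontal bond merge, so the number of sites drops. -/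
theorem ne_deletion {i c d : ℤ} (h : P.IsDuplicate i c d) : P ≠ deletion h := by
  intro heq
  have h1 : P.graph.verts = P.close i c d '' P.graph.verts :=
    congrArg (fun Q : SelfAvoidingPolygon => Q.graph.verts) heq
  have h2 : (P.close i c d '' P.graph.verts).ncard = P.graph.verts.ncard := by rw [← h1]
  have hinj := (Set.ncard_image_iff P.finite_verts).1 h2
  obtain ⟨_, y, hc, hd, hH, -⟩ := h.2.1
  have := hinj (P.graph.edge_vert hH) (P.graph.edge_vert hH.symm) (by
    rw [close_eq_of_mem hc hd, close_eq_of_mem hc hd, if_neg (by omega), if_pos le_rfl,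
      add_sub_cancel_right])
  simp at this

theorem SectionMinimal.not_isDuplicate (hP : P.SectionMinimal) (i c d : ℤ) :
    ¬ P.IsDuplicate i c d := fun h =>
  ne_deletion h (hP _ (Relation.ReflTransGen.single (deletesTo_deletion h)))

end SelfAvoidingPolygon

theorem mainTheorem4 (k M : ℕ) (hk : 1 ≤ k) (P : SelfAvoidingPolygon) (hP : P.SectionMinimal)
    (hV : P.verticalBonds.ncard + 4 = 6 * k + 2 * M) :
    {S : Set (Sym2 (ℤ × ℤ)) | P.IsSection S ∧ ((2 * k : ℕ) : ℕ∞) ≤ S.encard}.encard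
      ≤ ((2 * M + 1 : ℕ) : ℕ∞) :=
  SelfAvoidingPolygon.encard_sections_le hk hP.not_isDuplicate hV
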